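/- **Setting.** Let $L$ and $S$ be finite sets of links and sources. Each link $l\in L$ has a finite capacity $c_l>0$ and a gain $\gamma_l>0$. Each source $s\in S$ has a finite set of routes (also written $s$), each route $r$ being a non-empty set of links; $R$ is the collection of all routes, and $H\in\{0,1\}^{L\times R}$ is the routing matrix, $H_{lr}=1$ iff $l\in r$. For rates $\mathbf x=(x_r)_{r\in R}$ and prices $\mathbf p=(p_l)_{l\in L}$ write $\mathbf x_s=(x_r)_{r\in s}$, $y_l=\sum_{r\in R}H_{lr}x_r$ and $q_r=\sum_{l\in L}H_{lr}p_l$. The MP-TCP/AQM fluid model is $$\dot x_r=k_r(\mathbf x_s)\,(\phi_r(\mathbf x_s)-q_r)^+_{x_r}\quad(r\in s,\ s\in S),\qquad \dot p_l=\gamma_l\,(y_l-c_l)^+_{p_l}\quad(l\in L),$$ where $(a)^+_x=a$ if $x>0$ and $\max\{0,a\}$ if $x\le 0$; the $k_r$ are positive gains and $\phi_r:\mathbb R_+^{s}\to(0,\infty]$. Write $\Phi_s=(\phi_r)_{r\in s}$. An equilibrium is a finite point $(\mathbf x,\mathbf p)$ such that for all $r\in s$, $s\in S$ and $l\in L$ $$x_r\ge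 0,\quad \phi_r(\mathbf x_s)\le q_r,\quad \phi_r(\mathbf x_s)=q_r\text{ if }x_r>0;\tag{1}$$ $$p_l\ge 0,\quad y_l\le c_l,\quad y_l=c_l\text{ if }p_l>0.\tag{2}$$ It depends on the $\phi_r$ but not on the gains; if $k_r>0$ everywhere, it is the same as a point with $\mathbf x,\mathbf p\ge 0$ at which all the right-hand sides of the model vanish. **Conditions.** - (Regularity) Each $\phi_r$ is continuous on $\mathbb R_+^{s}$ as a function with values in $(0,\infty]$, and $\phi_r(\mathbf x_s)<\infty$ whenever $x_r>0$. - (C1) For each $s\in S$ there is a solution $\mathbf x_s(\mathbf p)\ge 0$ of (1) for every finite $\mathbf p\ge 0$ such that $q_r>0$ for all $r\in R$; moreover, for each link $l$, $y^s_l(\mathbf p)=\sum_{r\in s}H_{lr}x_r(\mathbf p)$ satisfies $\partial y^s_l(\mathbf p)/\partial p_l\le 0$ (the derivative exists, and is one-sided at $p_l=0$) and $\lim_{p_l\to\infty}y^s_l(\mathbf p)=0$. - (C2) For each $s\in S$, $\Phi_s$ is finite and continuously differentiable on the set of $\mathbf x_s$ with all entries positive, and there the symmetric part of its Jacobian is negative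 definite. - (C3) For each $r\in s$, $s\in S$ and each $\mathbf x_s\ge 0$, $\phi_r(\mathbf x_s)=\infty$ if and only if $x_r=0$; and $H$ has full row rank. **Theorem.** 1. If the regularity condition and C1 hold, then the fluid model has at least one equilibrium. 2. If C2 and C3 hold, then the fluid model has at most one equilibrium. Thus, if the regularity condition and C1–C3 hold, then the fluid model has a unique equilibrium $(\mathbf x^*,\mathbf p^*)$. -/

import Mathlib

open scoped ENNReal

/-- The projected drift `(a)_x^+`: it is `a` if `x > 0` and `max 0 a` if `x ≤ 0`. -/
noncomputable def projDrift {α : Type*} [LinearOrder α] [Zero α] (x : ℝ) (a : α) : α :=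
  if 0 < x then a else max 0 a

/-- A multipath TCP / AQM fluid model with links `L`, sources `S` and, for each source `s`,
the routes `Rt s` available to it; the set of all routes is `Σ s, Rt s`. -/
structure FluidModel (L S : Type*) (Rt : S → Type*) where
  /-- the set of links that a route consists of -/
  links : ∀ s, Rt s → Finset L
  links_nonempty : ∀ s r, (links s r).Nonempty
  /-- link capacities -/
  c : L → ℝ
  c_pos : ∀ l, 0 < c l
  /-- gains of the sources; `k s r` is a function of the rate vector of the source `s` -/
  k : ∀ s, Rt s → (Rt s → ℝ) → ℝ
  k_pos : ∀ s r x, 0 ≤ x → 0 < x r → 0 < k s r x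
  /-- gains of the links -/
  γ : L → ℝ
  γ_pos : ∀ l, 0 < γ l
  /-- the functions that determine the equilibria. Only their values at rate vectors with
  nonnegative entries matter, and the value `∞` is allowed. -/
  φ : ∀ s, Rt s → (Rt s → ℝ) → ℝ≥0∞
  /-- `φ` does not vanish at any finite rate vector -/
  φ_ne_zero : ∀ s r x, 0 ≤ x → φ s r x ≠ 0

namespace FluidModel

section

variable {L S : Type*} {Rt : S → Type*}

open Classical in
/-- The routing matrix. -/
noncomputable def H (N : FluidModel L S Rt) : Matrix L (Σ s, Rt s) ℝ :=
  fun l r => if l ∈ N.links r.1 r.2 then 1 else 0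

/-- The aggregate price `q_r` on a route. -/
noncomputable def routePrice [Fintype L] (N : FluidModel L S Rt) (p : L → ℝ) (s : S) (r : Rt s) :
    ℝ :=
  ∑ l, N.H l ⟨s, r⟩ * p l

/-- The traffic at the link `l` from the source `s`, when `s` has the rate vector `xs`. -/
noncomputable def sourceLoad (N : FluidModel L S Rt) (s : S) [Fintype (Rt s)] (xs : Rt s → ℝ)
    (l : L) : ℝ :=
  ∑ r, N.H l ⟨s, r⟩ * xs r

/-- The aggregate traffic `y_l` at a link. -/
noncomputable def load [Fintype S] [∀ s, Fintype (Rt s)] (N : FluidModel L S Rt)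
    (x : ∀ s, Rt s → ℝ) (l : L) : ℝ :=
  ∑ r : Σ s, Rt s, N.H l r * x r.1 r.2

/-- The right-hand side of the equation for the rate `x_r` (infinite if `φ_r` is). -/
noncomputable def rateDrift [Fintype L] (N : FluidModel L S Rt) (x : ∀ s, Rt s → ℝ) (p : L → ℝ)
    (s : S) (r : Rt s) : EReal :=
  (N.k s r (x s) : EReal) *
    projDrift (x s r) ((N.φ s r (x s) : EReal) - (N.routePrice p s r : EReal))

/-- The right-hand side of the equation for the price `p_l`. -/
noncomputable def priceDrift [Fintype S] [∀ s, Fintype (Rt s)] (N : FluidModel L S Rt)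
    (x : ∀ s, Rt s → ℝ) (p : L → ℝ) (l : L) : ℝ :=
  N.γ l * projDrift (p l) (N.load x l - N.c l)

/-- The equilibrium condition for the rate vector `xs` of the source `s` at prices `p ≥ 0`:
`x_r ≥ 0`, `φ_r(x_s) ≤ q_r`, and `φ_r(x_s) = q_r` if `x_r > 0`. -/
def IsSourceEquilibrium [Fintype L] (N : FluidModel L S Rt) (p : L → ℝ) (s : S)
    (xs : Rt s → ℝ) : Prop :=
  ∀ r, 0 ≤ xs r ∧ N.φ s r xs ≤ ENNReal.ofReal (N.routePrice p s r) ∧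
    (0 < xs r → N.φ s r xs = ENNReal.ofReal (N.routePrice p s r))

/-- The equilibrium condition for the prices: `p_l ≥ 0`, `y_l ≤ c_l`, and `y_l = c_l` if
`p_l > 0`. -/
def IsLinkEquilibrium [Fintype S] [∀ s, Fintype (Rt s)] (N : FluidModel L S Rt)
    (x : ∀ s, Rt s → ℝ) (p : L → ℝ) : Prop :=
  ∀ l, 0 ≤ p l ∧ N.load x l ≤ N.c l ∧ (0 < p l → N.load x l = N.c l)

/-- A (finite) equilibrium of the fluid model, in complementarity form. The equivalent form
through the vanishing of the drifts is `isEquilibrium_iff_drift_eq_zero`. -/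
def IsEquilibrium [Fintype L] [Fintype S] [∀ s, Fintype (Rt s)] (N : FluidModel L S Rt)
    (x : ∀ s, Rt s → ℝ) (p : L → ℝ) : Prop :=
  (∀ s, N.IsSourceEquilibrium p s (x s)) ∧ N.IsLinkEquilibrium x p

theorem projDrift_eq_zero_iff {a x : ℝ} :
    projDrift x a = 0 ↔ a ≤ 0 ∧ (0 < x → a = 0) := by
  unfold projDrift
  split_ifs with h
  · constructor
    · intro h0
      exact ⟨h0.le, fun _ => h0⟩
    · intro h0
      exact h0.2 h
  · rw [max_eq_left_iff]
    exact ⟨fun h0 => ⟨h0, fun h1 => absurd h1 h⟩, fun h0 => h0.1⟩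

theorem routePrice_nonneg [Fintype L] (N : FluidModel L S Rt) {p : L → ℝ} (hp : 0 ≤ p) (s : S)
    (r : Rt s) : 0 ≤ N.routePrice p s r := by
  refine Finset.sum_nonneg fun l _ => mul_nonneg ?_ (hp l)
  unfold H
  split_ifs <;> norm_num

/-- If all gains of the sources are positive, a point with nonnegative rates and prices is an
equilibrium if and only if all drifts of the fluid model vanish there. -/
theorem isEquilibrium_iff_drift_eq_zero [Fintype L] [Fintype S] [∀ s, Fintype (Rt s)]
    (N : FluidModel L S Rt) (hk : ∀ s r x, 0 ≤ x → 0 < N.k s r x)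
    (x : ∀ s, Rt s → ℝ) (p : L → ℝ) (hx : 0 ≤ x) (hp : 0 ≤ p) :
    N.IsEquilibrium x p ↔
      (∀ s r, N.rateDrift x p s r = 0) ∧ ∀ l, N.priceDrift x p l = 0 := by
  unfold IsEquilibrium
  apply and_congr
  · refine forall_congr' fun s => forall_congr' fun r => ?_
    have hx' : 0 ≤ x s r := hx s r
    have hq := N.routePrice_nonneg hp s r
    have hk' := hk s r (x s) (hx s)
    unfold rateDrift
    generalize N.routePrice p s r = q at *
    generalize N.k s r (x s) = k at *
    generalize N.φ s r (x s) = f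
    have hk0 : (k : EReal) ≠ 0 := by
      exact_mod_cast hk'.ne'
    rw [mul_eq_zero, or_iff_right hk0]
    simp only [hx', true_and]
    induction f using ENNReal.recTopCoe with
    | top =>
      simp only [top_le_iff, ENNReal.ofReal_ne_top, false_and, false_iff, EReal.coe_ennreal_top,
        EReal.top_sub_coe, projDrift]
      split_ifs <;> simp
    | coe f =>
      have h1 : ((f : ℝ≥0∞) : EReal) - (q : EReal) = (((f : ℝ) - q : ℝ) : EReal) := by
        rw [EReal.coe_sub]
        rfl
      have h2 : projDrift (x s r) ((((f : ℝ) - q : ℝ)) : EReal) =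
          ((projDrift (x s r) ((f : ℝ) - q) : ℝ) : EReal) := by
        unfold projDrift
        split_ifs
        · rfl
        · rw [EReal.coe_strictMono.monotone.map_max]
          rfl
      have h3 : (f : ℝ≥0∞) = ENNReal.ofReal (f : ℝ) := (ENNReal.ofReal_coe_nnreal).symm
      rw [h1, h2, EReal.coe_eq_zero, projDrift_eq_zero_iff, h3,
        ENNReal.ofReal_le_ofReal_iff hq, ENNReal.ofReal_eq_ofReal_iff (NNReal.coe_nonneg f) hq, sub_nonpos,
        sub_eq_zero]
  · refine forall_congr' fun l => ?_
    have hp' : 0 ≤ p l := hp l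
    unfold priceDrift
    rw [mul_eq_zero, or_iff_right (N.γ_pos l).ne', projDrift_eq_zero_iff, sub_nonpos,
      sub_eq_zero]
    simp only [hp', true_and]

/-- `Φ_s` as a real vector field, meaningful where it is finite. -/
noncomputable def realΦ (N : FluidModel L S Rt) (s : S) (xs : Rt s → ℝ) : Rt s → ℝ :=
  fun r => (N.φ s r xs).toReal

open Classical in
/-- The Jacobian matrix of `Φ_s`. -/
noncomputable def jacobian (N : FluidModel L S Rt) (s : S) [Fintype (Rt s)] (xs : Rt s → ℝ) :
    Matrix (Rt s) (Rt s) ℝ :=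
  fun i j => fderiv ℝ (N.realΦ s) xs (Pi.single j 1) i

/-- The standing regularity of `Φ`: each `φ_r` is continuous on the rate vectors with nonnegative
entries, as a function with values in `(0, ∞]`, and is finite where `x_r > 0`. -/
def IsRegular (N : FluidModel L S Rt) : Prop :=
  ∀ s r, ContinuousOn (N.φ s r) {xs | 0 ≤ xs} ∧
    ∀ xs : Rt s → ℝ, 0 ≤ xs → 0 < xs r → N.φ s r xs ≠ ∞

open Classical in
/-- Each source `s` has rates `x_s(p)` that satisfy its equilibrium condition at all `p ≥ 0` with
`q_r > 0` for all routes `r`, such that the load `y^s_l(p)` that it puts on a link `l` satisfies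
`∂y^s_l/∂p_l ≤ 0` (one-sided at `p_l = 0`) and `y^s_l(p) → 0` as `p_l → ∞`. -/
def HasDecreasingDemand [Fintype L] [∀ s, Fintype (Rt s)] (N : FluidModel L S Rt) : Prop :=
  ∀ s, ∃ xs : (L → ℝ) → Rt s → ℝ,
    ∀ p : L → ℝ, 0 ≤ p → (∀ s' r, 0 < N.routePrice p s' r) →
      N.IsSourceEquilibrium p s (xs p) ∧
      ∀ l,
        (∃ d ≤ 0, HasDerivWithinAt (fun t => N.sourceLoad s (xs (Function.update p l t)) l) d
          (Set.Ici 0) (p l)) ∧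
        Filter.Tendsto (fun t => N.sourceLoad s (xs (Function.update p l t)) l)
          Filter.atTop (nhds 0)

/-- `Φ_s` is finite and continuously differentiable at the positive rate vectors, and the symmetric
part of its Jacobian is negative definite there. -/
def HasNegDefJacobian [∀ s, Fintype (Rt s)] (N : FluidModel L S Rt) : Prop :=
  ∀ s, (∀ xs : Rt s → ℝ, (∀ r, 0 < xs r) → ∀ r, N.φ s r xs ≠ ∞) ∧
    ContDiffOn ℝ 1 (N.realΦ s) {xs | ∀ r, 0 < xs r} ∧
    ∀ xs : Rt s → ℝ, (∀ r, 0 < xs r) →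
      (-((1 / 2 : ℝ) • (N.jacobian s xs + (N.jacobian s xs).transpose))).PosDef

/-- `φ_r(x_s) = ∞` if and only if `x_r = 0`, and the routing matrix has full row rank. -/
def HasInfinitePriceAtZero [Fintype L] [Fintype S] [∀ s, Fintype (Rt s)]
    (N : FluidModel L S Rt) : Prop :=
  (∀ s r, ∀ xs : Rt s → ℝ, 0 ≤ xs → (N.φ s r xs = ∞ ↔ xs r = 0)) ∧
    N.H.rank = Fintype.card L

end

end FluidModel

/-!
Existence. The equilibrium conditions form a nonlinear complementarity problem in the rates and
prices jointly. With `φ` truncated at a level `K` and the unknowns restricted to a box, it is the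
variational inequality of a continuous vector field, and it has a solution by Brouwer's theorem
(`exists_variationalInequality_Icc`). The box and the truncation do not matter if they are large
enough. A link with a positive price is saturated, hence lies on some route that carries a
substantial share of its capacity; on such rate vectors `φ` of that route is continuous and finite
on a compact set, hence at most some `M` (`FluidModel.IsRegular.exists_bound`). The price of that
route equals its `φ`, so all link prices are at most `M`. Therefore no price is at the boundary of
the box, no link is overloaded, no rate exceeds the smallest capacity on its route, and all route
prices are at most `M` times the number of links, which is below `K`. This uses only the continuity
and finiteness properties of `φ` (`FluidModel.IsRegular.exists_isEquilibrium`).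

Brouwer's theorem is derived from Scarf's lemma (`exists_dominant_colorful`), a variant of
Sperner's lemma in which a triangulation is replaced by a finite set with several linear orders.
Its proof counts modulo 2 the pairs of an almost completely coloured dominant set and a dominant
set with one element more that contains it. Applied to the lattice points of a dilated simplex, each
coloured by a coordinate that does not decrease under the map, it gives approximate fixed points.

Uniqueness. If `φ` is infinite at zero rates, all rates are positive at an equilibrium, so
`Φ_s(x_s) = q` there. For two equilibria, `∑ (x' - x) (Φ(x') - Φ(x)) = ∑ (x' - x) (q' - q)`, which
equals `∑ (y' - y) (p' - p)` and is nonnegative by complementarity. The negative definite Jacobian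
makes the left-hand side negative unless `x = x'`
(`FluidModel.HasNegDefJacobian.inner_sub_neg`). Then the route prices agree, and so do the link
prices, as the routing matrix has full row rank.
-/

/-! ### Scarf's lemma -/

section Scarf

variable {I W α : Type*} [LinearOrder α]

/-- A finite set `σ` is dominant for the family of utilities `u` if no `y` is strictly better than
the worst element of `σ` with respect to every utility at once. -/
def Dominant (u : I → W → α) (σ : Finset W) : Prop :=
  ∀ y, ∃ i, ∀ x ∈ σ, u i y ≤ u i x

theorem Dominant.mono {u : I → W → α} {σ τ : Finset W} (h : Dominant u σ) (hτ : τ ⊆ σ) :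
    Dominant u τ := fun y => (h y).imp fun _ hi x hx => hi x (hτ hx)

/-- `x` is the best element for `u a` among those that are better than the worst element `m k`
with respect to `u k`, for all `k ≠ a`. -/
def IsReplacement (u : I → W → α) (m : I → W) (a : I) (x : W) : Prop :=
  (∀ k, k ≠ a → u k (m k) < u k x) ∧
    ∀ y, (∀ k, k ≠ a → u k (m k) < u k y) → u a y ≤ u a x

/-- A worst element of a nonempty dominant set for each utility; every element of the set is a
worst one for some utility. -/
theorem Dominant.exists_worst {u : I → W → α} (hu : ∀ i, Function.Injective (u i)) {τ : Finset W}
    (h : Dominant u τ) (hne : τ.Nonempty) :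
    ∃ m : I → W, (∀ i, m i ∈ τ) ∧ (∀ i, ∀ x ∈ τ, u i (m i) ≤ u i x) ∧ ∀ x ∈ τ, ∃ i, m i = x := by
  choose m hm hmin using fun i => τ.exists_min_image (u i) hne
  refine ⟨m, hm, hmin, fun x hx => ?_⟩
  obtain ⟨i, hi⟩ := h x
  exact ⟨i, hu i (le_antisymm (hmin i x hx) (hi _ (hm i)))⟩

theorem existsUnique_isReplacement [Finite W] {u : I → W → α} (hu : ∀ i, Function.Injective (u i))
    (m : I → W) (a : I) (hne : ∃ y, ∀ k, k ≠ a → u k (m k) < u k y) :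
    ∃! x, IsReplacement u m a x := by
  obtain ⟨x, hx, hmax⟩ := Set.exists_max_image {y | ∀ k, k ≠ a → u k (m k) < u k y} (u a)
    (Set.toFinite _) hne
  refine ⟨x, ⟨hx, hmax⟩, fun z hz => hu a (le_antisymm (hmax z hz.1) (hz.2 x hx))⟩

variable [Fintype I] [DecidableEq I] [DecidableEq W]

/-- If the utilities `i` and `j` share their worst element of a dominant set that has one element
less than there are utilities, then the dominant completions of the set are the replacements for
`i` and for `j`. -/
theorem Dominant.insert_iff {u : I → W → α} (hu : ∀ i, Function.Injective (u i)) {τ : Finset W}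
    (h : Dominant u τ) (hcard : τ.card + 1 = Fintype.card I) {m : I → W} (hm : ∀ i, m i ∈ τ)
    (hmin : ∀ i, ∀ x ∈ τ, u i (m i) ≤ u i x) (hsurj : ∀ x ∈ τ, ∃ i, m i = x)
    {i j : I} (hij : i ≠ j) (hmij : m i = m j) (x : W) :
    (x ∉ τ ∧ Dominant u (insert x τ)) ↔ IsReplacement u m i x ∨ IsReplacement u m j x := by
  constructor
  · rintro ⟨hx, hd⟩
    obtain ⟨m', hm', hmin', hsurj'⟩ := hd.exists_worst hu (Finset.insert_nonempty x τ)
    have hinj : Function.Injective m' := by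
      have h1 : Finset.univ.image m' = insert x τ := by
        ext y
        simp only [Finset.mem_image, Finset.mem_univ, true_and]
        exact ⟨fun ⟨k, hk⟩ => hk ▸ hm' k, hsurj' y⟩
      have h2 : (Finset.univ.image m').card = (Finset.univ : Finset I).card := by
        rw [h1, Finset.card_insert_of_notMem hx, hcard, Finset.card_univ]
      have := Finset.card_image_iff.1 h2
      simpa [Set.injOn_univ] using this
    obtain ⟨a, ha⟩ := hsurj' x (Finset.mem_insert_self _ _)
    have hk : ∀ k, k ≠ a → m' k = m k := fun k hk => by
      have h1 : m' k ∈ τ := by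
        refine (Finset.mem_insert.1 (hm' k)).resolve_left fun h2 => hk (hinj (h2.trans ha.symm))
      exact hu k (le_antisymm (hmin' k _ (Finset.mem_insert_of_mem (hm k))) (hmin k _ h1))
    have hrep : IsReplacement u m a x := by
      refine ⟨fun k hka => ?_, fun y hy => ?_⟩
      · refine lt_of_le_of_ne ?_ fun h1 => hx (hu k h1 ▸ hm k)
        rw [← hk k hka]
        exact hmin' k x (Finset.mem_insert_self _ _)
      · obtain ⟨k, hky⟩ := hd y
        by_cases hka : k = a
        · exact hka ▸ hky x (Finset.mem_insert_self _ _)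
        · exact absurd (hky _ (Finset.mem_insert_of_mem (hm k))) (not_le.2 (hy k hka))
    by_cases hai : a = i
    · exact Or.inl (hai ▸ hrep)
    by_cases haj : a = j
    · exact Or.inr (haj ▸ hrep)
    refine absurd (hinj ?_) hij
    rw [hk i (Ne.symm hai), hk j (Ne.symm haj), hmij]
  · have key : ∀ a b : I, a ≠ b → m a = m b → IsReplacement u m a x →
        x ∉ τ ∧ Dominant u (insert x τ) := by
      intro a b hab hmab hrep
      constructor
      · intro hx
        obtain ⟨k, rfl⟩ := hsurj x hx
        by_cases hka : k = a
        · subst hka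
          have := hrep.1 b hab.symm
          rw [hmab] at this
          exact lt_irrefl _ this
        · exact lt_irrefl _ (hrep.1 k hka)
      · intro y
        by_cases hy : ∀ k, k ≠ a → u k (m k) < u k y
        · obtain ⟨k, hk⟩ := h y
          have hka : k = a := by
            by_contra hka
            exact absurd (hk _ (hm k)) (not_le.2 (hy k hka))
          subst hka
          refine ⟨k, fun z hz => ?_⟩
          rcases Finset.mem_insert.1 hz with rfl | hz
          · exact hrep.2 y hy
          · exact hk z hz
        · push Not at hy
          obtain ⟨k, hka, hk⟩ := hy
          refine ⟨k, fun z hz => ?_⟩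
          rcases Finset.mem_insert.1 hz with rfl | hz
          · exact hk.trans (hrep.1 k hka).le
          · exact hk.trans (hmin k z hz)
    rintro (h1 | h1)
    · exact key i j hij hmij h1
    · exact key j i hij.symm hmij.symm h1

open Classical in
/-- A set with as many elements as there are colours contains an odd number of almost completely
coloured sets, lacking the colour `i₀`, if and only if it is completely coloured. -/
theorem odd_card_erase_iff (c : W → I) (i₀ : I) {σ : Finset W} (hcard : σ.card = Fintype.card I) :
    Odd (σ.filter fun x => (σ.erase x).image c = Finset.univ.erase i₀).card ↔
      σ.image c = Finset.univ := by
  have hE : (Finset.univ.erase i₀ : Finset I).card + 1 = Fintype.card I := by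
    rw [Finset.card_erase_add_one (Finset.mem_univ _), Finset.card_univ]
  by_cases hc : σ.image c = Finset.univ
  · simp only [hc, iff_true]
    have hinj : Set.InjOn c σ := Finset.card_image_iff.1 (by rw [hc, hcard, Finset.card_univ])
    obtain ⟨x, hx, hxc⟩ := Finset.mem_image.1 (hc ▸ Finset.mem_univ i₀)
    have : (σ.filter fun x => (σ.erase x).image c = Finset.univ.erase i₀) = {x} := by
      ext z
      simp only [Finset.mem_filter, Finset.mem_singleton]
      constructor
      · rintro ⟨hz, hze⟩
        by_contra hne
        have : c x ∈ (σ.erase z).image c :=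
          Finset.mem_image_of_mem _ (Finset.mem_erase.2 ⟨Ne.symm hne, hx⟩)
        rw [hze, hxc] at this
        simp at this
      · rintro rfl
        refine ⟨hx, ?_⟩
        ext i
        simp only [Finset.mem_image, Finset.mem_erase, Finset.mem_univ, and_true]
        constructor
        · rintro ⟨w, ⟨hwz, hw⟩, rfl⟩ h1
          exact hwz (hinj hw hx (h1.trans hxc.symm))
        · intro hi
          obtain ⟨w, hw, rfl⟩ := Finset.mem_image.1 (hc ▸ Finset.mem_univ i)
          refine ⟨w, ⟨?_, hw⟩, rfl⟩
          rintro rfl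
          exact hi hxc
    rw [this]
    simp
  · simp only [hc, iff_false, Nat.not_odd_iff_even]
    rcases (σ.filter fun x => (σ.erase x).image c = Finset.univ.erase i₀).eq_empty_or_nonempty with
      h0 | ⟨x, hx⟩
    · rw [h0]
      simp
    obtain ⟨hx, hxe⟩ := Finset.mem_filter.1 hx
    have hinj : Set.InjOn c (σ.erase x) := by
      refine Finset.card_image_iff.1 ?_
      have := Finset.card_erase_add_one hx
      rw [hxe]
      omega
    have hcx : c x ≠ i₀ := by
      intro h1
      refine hc (Finset.eq_univ_iff_forall.2 fun i => ?_)
      by_cases hi : i = i₀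
      · rw [hi, ← h1]
        exact Finset.mem_image_of_mem _ hx
      · have : i ∈ (σ.erase x).image c := by
          rw [hxe]
          simp [hi]
        exact Finset.image_subset_image (Finset.erase_subset _ _) this
    obtain ⟨x', hx', hcx'⟩ := Finset.mem_image.1
      (show c x ∈ (σ.erase x).image c by rw [hxe]; simp [hcx])
    obtain ⟨hxx', hx'σ⟩ := Finset.mem_erase.1 hx'
    have : (σ.filter fun x => (σ.erase x).image c = Finset.univ.erase i₀) = {x, x'} := by
      ext z
      simp only [Finset.mem_filter, Finset.mem_singleton, Finset.mem_insert]
      constructor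
      · rintro ⟨hz, hze⟩
        by_contra! hne
        have hz' : z ∈ σ.erase x := Finset.mem_erase.2 ⟨hne.1, hz⟩
        have : c z ∈ (σ.erase z).image c := by
          rw [hze, ← hxe]
          exact Finset.mem_image_of_mem _ hz'
        obtain ⟨w, hw, hwz⟩ := Finset.mem_image.1 this
        obtain ⟨hwz', hw⟩ := Finset.mem_erase.1 hw
        by_cases hwx : w = x
        · subst hwx
          exact hne.2 (hinj hz' hx' (hwz.symm.trans hcx'.symm))
        · exact hwz' (hinj (Finset.mem_coe.2 (Finset.mem_erase.2 ⟨hwx, hw⟩)) hz' hwz)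
      · rintro (rfl | rfl)
        · exact ⟨hx, hxe⟩
        · refine ⟨hx'σ, ?_⟩
          rw [← hxe]
          ext i
          simp only [Finset.mem_image, Finset.mem_erase]
          constructor
          · rintro ⟨w, ⟨hwz, hw⟩, rfl⟩
            by_cases hwx : w = x
            · exact ⟨z, ⟨hxx', hx'σ⟩, by rw [hcx', hwx]⟩
            · exact ⟨w, ⟨hwx, hw⟩, rfl⟩
          · rintro ⟨w, ⟨hwx, hw⟩, rfl⟩
            by_cases hwz : w = z
            · exact ⟨x, ⟨hxx'.symm, hx⟩, by rw [hwz, hcx']⟩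
            · exact ⟨w, ⟨hwz, hw⟩, rfl⟩
    rw [this, Finset.card_pair hxx'.symm]
    exact even_two

variable [Fintype W]

open Classical in
/-- A dominant set with one element less than there are utilities, not made of slack elements
only, can be completed to a dominant set in exactly two ways. The slack element `s j` is better
than all ordinary elements for every utility but `u j`. -/
theorem Dominant.card_completions {u : I → W → α} (hu : ∀ i, Function.Injective (u i)) {s : I → W}
    (hs : ∀ i j w, i ≠ j → w ∉ Set.range s → u i w < u i (s j)) {τ : Finset W}
    (h : Dominant u τ) (hcard : τ.card + 1 = Fintype.card I) (hτ : ∃ w ∈ τ, w ∉ Set.range s) :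
    (Finset.univ.filter fun x => x ∉ τ ∧ Dominant u (insert x τ)).card = 2 := by
  obtain ⟨w, hw, hws⟩ := hτ
  obtain ⟨m, hm, hmin, hsurj⟩ := h.exists_worst hu ⟨w, hw⟩
  -- There are more utilities than elements of `τ`, so two of them share their worst element.
  obtain ⟨i, -, j, -, hij, hmij⟩ := Finset.exists_ne_map_eq_of_card_lt_of_maps_to
    (s := Finset.univ) (t := τ) (f := m) (by rw [Finset.card_univ]; omega) fun i _ => hm i
  have hne : ∀ a, ∃ y, ∀ k, k ≠ a → u k (m k) < u k y := fun a =>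
    ⟨s a, fun k hk => (hmin k w hw).trans_lt (hs k a w hk hws)⟩
  obtain ⟨x, hx, hxu⟩ := existsUnique_isReplacement hu m i (hne i)
  obtain ⟨y, hy, hyu⟩ := existsUnique_isReplacement hu m j (hne j)
  rw [Finset.card_eq_two]
  refine ⟨x, y, ?_, ?_⟩
  · rintro rfl
    obtain ⟨k, hk⟩ := h x
    have := hk _ (hm k)
    by_cases hki : k = i
    · exact absurd this (not_le.2 (hy.1 k (hki ▸ hij)))
    · exact absurd this (not_le.2 (hx.1 k hki))
  · ext z
    simp only [Finset.mem_filter, Finset.mem_univ, true_and, Finset.mem_insert,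
      Finset.mem_singleton]
    rw [h.insert_iff hu hcard hm hmin hsurj hij hmij z]
    constructor
    · rintro (h1 | h1)
      · exact Or.inl (hxu z h1)
      · exact Or.inr (hyu z h1)
    · rintro (rfl | rfl)
      · exact Or.inl hx
      · exact Or.inr hy

open Classical in
/-- The set of all slack elements but one has exactly one dominant completion. -/
theorem card_completions_slack {u : I → W → α} (hu : ∀ i, Function.Injective (u i)) {s : I → W}
    (hsi : Function.Injective s) (hs0 : ∀ i w, u i (s i) ≤ u i w)
    (hs : ∀ i j w, i ≠ j → w ∉ Set.range s → u i w < u i (s j)) (i₀ : I) :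
    (Finset.univ.filter fun x => x ∉ (Finset.univ.erase i₀).image s ∧
      Dominant u (insert x ((Finset.univ.erase i₀).image s))).card = 1 := by
  have hmem : ∀ y, y ∉ (Finset.univ.erase i₀).image s ↔ ∀ k, k ≠ i₀ → s k ≠ y := fun y => by
    simp
  obtain ⟨x, hx, hmax⟩ := Set.exists_max_image {y | ∀ k, k ≠ i₀ → s k ≠ y} (u i₀)
    (Set.toFinite _) ⟨s i₀, fun k hk h => hk (hsi h)⟩
  rw [Finset.card_eq_one]
  refine ⟨x, ?_⟩
  ext z
  simp only [Finset.mem_filter, Finset.mem_univ, true_and, Finset.mem_singleton, hmem]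
  constructor
  · rintro ⟨hz, hd⟩
    obtain ⟨k, hk⟩ := hd x
    have hk0 : k = i₀ := by
      by_contra hk0
      refine hx k hk0 (hu k (le_antisymm (hs0 k x) (hk _ ?_)))
      exact Finset.mem_insert_of_mem (Finset.mem_image_of_mem _ (by simp [hk0]))
    subst hk0
    exact hu k (le_antisymm (hmax z hz) (hk z (Finset.mem_insert_self _ _)))
  · rintro rfl
    refine ⟨hx, fun y => ?_⟩
    by_cases hy : ∀ k, k ≠ i₀ → s k ≠ y
    · refine ⟨i₀, fun w hw => ?_⟩
      rcases Finset.mem_insert.1 hw with rfl | hw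
      · exact hmax y hy
      obtain ⟨k, hk, rfl⟩ := Finset.mem_image.1 hw
      have hk0 : k ≠ i₀ := (Finset.mem_erase.1 hk).1
      by_cases hys : y ∈ Set.range s
      · obtain ⟨l, rfl⟩ := hys
        have hl : l = i₀ := by
          by_contra hl
          exact hy l hl rfl
        subst hl
        exact hs0 _ _
      · exact (hs i₀ k y hk0.symm hys).le
    · push Not at hy
      obtain ⟨k, _, rfl⟩ := hy
      exact ⟨k, fun w _ => hs0 _ _⟩

/-- **Scarf's lemma**: for any colouring in which the slack element `s i` has the colour `i`, there
is a dominant set that contains one element of each colour. -/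
theorem exists_dominant_colorful [Nonempty I] {u : I → W → α}
    (hu : ∀ i, Function.Injective (u i)) {s : I → W} (hs0 : ∀ i w, u i (s i) ≤ u i w)
    (hs : ∀ i j w, i ≠ j → w ∉ Set.range s → u i w < u i (s j)) (c : W → I)
    (hc : ∀ i, c (s i) = i) :
    ∃ w : I → W, (∀ j, c (w j) = j) ∧ ∀ y, ∃ i, ∀ j, u i y ≤ u i (w j) := by
  classical
  obtain ⟨i₀⟩ := ‹Nonempty I›
  have hsi : Function.Injective s := fun a b hab => by rw [← hc a, hab, hc]
  have hE : (Finset.univ.erase i₀ : Finset I).card + 1 = Fintype.card I := by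
    rw [Finset.card_erase_add_one (Finset.mem_univ _), Finset.card_univ]
  -- Rooms are the dominant sets of full size, doors the almost completely coloured ones of size
  -- one less; the pairs of a door in a room are counted in two ways, modulo 2.
  let rooms : Finset (Finset W) :=
    Finset.univ.filter fun σ => σ.card = Fintype.card I ∧ Dominant u σ
  let doors : Finset (Finset W) := Finset.univ.filter fun τ =>
    τ.card + 1 = Fintype.card I ∧ Dominant u τ ∧ τ.image c = Finset.univ.erase i₀
  have hcount := Finset.sum_card_bipartiteAbove_eq_sum_card_bipartiteBelow (s := doors)
    (t := rooms) (fun τ σ => τ ⊆ σ)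
  have hdoor : ∀ τ ∈ doors, (Finset.bipartiteAbove (fun τ σ => τ ⊆ σ) rooms τ).card =
      (Finset.univ.filter fun x => x ∉ τ ∧ Dominant u (insert x τ)).card := by
    intro τ hτ
    have hτ' := (Finset.mem_filter.1 hτ).2
    symm
    refine Finset.card_bij (fun x _ => insert x τ) ?_ ?_ ?_
    · intro x hx
      have hx' := (Finset.mem_filter.1 hx).2
      simp only [Finset.mem_bipartiteAbove, rooms, Finset.mem_filter, Finset.mem_univ, true_and]
      exact ⟨⟨by rw [Finset.card_insert_of_notMem hx'.1, hτ'.1], hx'.2⟩, Finset.subset_insert _ _⟩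
    · intro x hx y _ hxy
      have hx' := (Finset.mem_filter.1 hx).2
      have : x ∈ insert y τ := by
        rw [← hxy]
        exact Finset.mem_insert_self _ _
      exact (Finset.mem_insert.1 this).resolve_right hx'.1
    · intro σ hσ
      simp only [Finset.mem_bipartiteAbove, rooms, Finset.mem_filter, Finset.mem_univ,
        true_and] at hσ
      obtain ⟨x, hx, rfl⟩ := Finset.exists_eq_insert_iff.2 ⟨hσ.2, hτ'.1.trans hσ.1.1.symm⟩
      exact ⟨x, by simp [hx, hσ.1.2], rfl⟩
  have hroom : ∀ σ ∈ rooms, (Finset.bipartiteBelow (fun τ σ => τ ⊆ σ) doors σ).card =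
      (σ.filter fun x => (σ.erase x).image c = Finset.univ.erase i₀).card := by
    intro σ hσ
    have hσ' := (Finset.mem_filter.1 hσ).2
    symm
    refine Finset.card_bij (fun x _ => σ.erase x) ?_ ?_ ?_
    · intro x hx
      have hx' := Finset.mem_filter.1 hx
      simp only [Finset.mem_bipartiteBelow, doors, Finset.mem_filter, Finset.mem_univ, true_and]
      exact ⟨⟨by rw [Finset.card_erase_add_one hx'.1, hσ'.1],
        hσ'.2.mono (Finset.erase_subset _ _), hx'.2⟩, Finset.erase_subset _ _⟩
    · intro x hx y _ hxy
      have hx' := Finset.mem_filter.1 hx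
      by_contra hne
      have : x ∈ σ.erase y := Finset.mem_erase.2 ⟨hne, hx'.1⟩
      rw [← hxy] at this
      simp at this
    · intro τ hτ
      simp only [Finset.mem_bipartiteBelow, doors, Finset.mem_filter, Finset.mem_univ,
        true_and] at hτ
      obtain ⟨x, hx, rfl⟩ := Finset.exists_eq_insert_iff.2 ⟨hτ.2, hτ.1.1.trans hσ'.1.symm⟩
      refine ⟨x, ?_, Finset.erase_insert hx⟩
      simp only [Finset.mem_filter, Finset.mem_insert_self, true_and, Finset.erase_insert hx]
      exact hτ.1.2.2
  rw [Finset.sum_congr rfl hdoor, Finset.sum_congr rfl hroom] at hcount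
  have hτ₀ : doors.filter (fun τ => Odd
      (Finset.univ.filter fun x => x ∉ τ ∧ Dominant u (insert x τ)).card) =
      {(Finset.univ.erase i₀).image s} := by
    ext τ
    rw [Finset.mem_filter, Finset.mem_singleton]
    constructor
    · rintro ⟨hτ, hodd⟩
      have hτ' := (Finset.mem_filter.1 hτ).2
      by_cases hw : ∃ w ∈ τ, w ∉ Set.range s
      · rw [hτ'.2.1.card_completions hu hs hτ'.1 hw] at hodd
        exact absurd hodd (by decide)
      · push Not at hw
        rw [← hτ'.2.2, Finset.image_image]
        ext w
        rw [Finset.mem_image]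
        constructor
        · intro hwτ
          refine ⟨w, hwτ, ?_⟩
          obtain ⟨i, rfl⟩ := hw w hwτ
          simp [hc]
        · rintro ⟨v, hv, rfl⟩
          obtain ⟨i, rfl⟩ := hw v hv
          simpa [hc] using hv
    · rintro rfl
      have h1 := card_completions_slack hu hsi hs0 hs i₀
      refine ⟨?_, by rw [h1]; exact odd_one⟩
      obtain ⟨x, hx⟩ := Finset.card_pos.1 (h1 ▸ Nat.one_pos)
      simp only [doors, Finset.mem_filter, Finset.mem_univ, true_and]
      refine ⟨?_, ((Finset.mem_filter.1 hx).2.2).mono (Finset.subset_insert _ _), ?_⟩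
      · rw [Finset.card_image_of_injective _ hsi, hE]
      · rw [Finset.image_image]
        have : c ∘ s = id := funext hc
        rw [this, Finset.image_id]
  have hodd : Odd (∑ σ ∈ rooms,
      (σ.filter fun x => (σ.erase x).image c = Finset.univ.erase i₀).card) := by
    rw [← hcount, Finset.odd_sum_iff_odd_card_odd, hτ₀]
    simp
  rw [Finset.odd_sum_iff_odd_card_odd] at hodd
  obtain ⟨σ, hσ⟩ := Finset.card_pos.1 hodd.pos
  obtain ⟨hσ, hσo⟩ := Finset.mem_filter.1 hσ
  have hσ' := (Finset.mem_filter.1 hσ).2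
  have himg := (odd_card_erase_iff c i₀ hσ'.1).1 hσo
  choose w hw hwc using fun j => Finset.mem_image.1 (himg ▸ Finset.mem_univ j : j ∈ σ.image c)
  exact ⟨w, hwc, fun y => (hσ'.2 y).imp fun i hi j => hi _ (hw j)⟩

end Scarf

/-! ### Brouwer's fixed point theorem -/

section Brouwer

/-- Scarf's lemma on the lattice points of a dilated simplex: for each colouring there is a lattice
point which is, in each coordinate `i`, close to `0` or close to a point of the colour `i`. -/
theorem exists_lattice_point_near_colors {I : Type*} [Fintype I] [Nonempty I] (N : ℕ)
    (c : (I → ℕ) → I) :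
    ∃ w : I → ℕ, ∑ i, w i = N ∧ ∀ i, w i ≤ Fintype.card I ∨
      ∃ v : I → ℕ, ∑ k, v k = N ∧ c v = i ∧
        ∀ k, v k ≤ w k + Fintype.card I ∧ w k ≤ v k + Fintype.card I := by
  classical
  let V := {a : I → Fin (N + 1) // ∑ i, (a i : ℕ) = N}
  have hV : ∀ v : I → ℕ, ∑ i, v i = N → ∃ a : V, ∀ i, (a.1 i : ℕ) = v i := fun v hv =>
    ⟨⟨fun i => ⟨v i, Nat.lt_succ_of_le (hv ▸ Finset.single_le_sum (fun _ _ => Nat.zero_le _)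
      (Finset.mem_univ i))⟩, hv⟩, fun i => rfl⟩
  -- The `i`-th utility of a lattice point is its `i`-th coordinate, with ties broken by a
  -- numbering; the slack element `inl i` is worst for the utility `i` and best for all others.
  let val : I → I ⊕ V → ℕ := fun i w =>
    Sum.elim (fun j => if i = j then 0 else N + 2) (fun v => (v.1 i : ℕ) + 1) w
  let u : I → I ⊕ V → ℕ ×ₗ ℕ := fun i w => toLex (val i w, (Fintype.equivFin (I ⊕ V) w : ℕ))
  have hlt : ∀ i w w', val i w < val i w' → u i w < u i w' := fun i w w' h =>
    Prod.Lex.toLex_lt_toLex.2 (Or.inl h)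
  have hle : ∀ i w w', u i w ≤ u i w' → val i w ≤ val i w' := fun i w w' h =>
    not_lt.1 fun h' => absurd h (not_le.2 (hlt i _ _ h'))
  have hu : ∀ i, Function.Injective (u i) := by
    intro i w w' h
    have h2 := congrArg (fun z => (ofLex z).2) h
    exact (Fintype.equivFin (I ⊕ V)).injective (Fin.ext h2)
  obtain ⟨w, hwc, hw⟩ := exists_dominant_colorful hu (s := Sum.inl)
    (by
      rintro i (j | v)
      · by_cases hij : i = j
        · rw [hij]
        · exact (hlt _ _ _ (by simp [val, hij])).le
      · exact (hlt _ _ _ (by simp [val])).le)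
    (by
      rintro i j (k | v) hij hw
      · exact absurd ⟨k, rfl⟩ hw
      · refine hlt _ _ _ ?_
        have := (v.1 i).2
        simp only [val, Sum.elim_inl, Sum.elim_inr, if_neg hij]
        omega)
    (Sum.elim id fun v => c fun i => v.1 i) (fun i => rfl)
  have hw' : ∀ j, w j = Sum.inl j ∨ ∃ v : V, w j = Sum.inr v := by
    intro j
    rcases h : w j with k | v
    · left
      have := hwc j
      rw [h] at this
      exact congrArg _ this
    · exact Or.inr ⟨v, rfl⟩
  let C : Finset I := Finset.univ.filter fun j => ∃ v : V, w j = Sum.inr v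
  have hC : ∀ j, j ∈ C ↔ ∃ v : V, w j = Sum.inr v := fun j => by simp [C]
  have hg : ∀ j, ∃ g : I → ℕ, j ∈ C → ∑ k, g k = N ∧ c g = j ∧ ∀ i, val i (w j) = g i + 1 := by
    intro j
    by_cases hj : j ∈ C
    · obtain ⟨v, hv⟩ := (hC j).1 hj
      refine ⟨fun i => v.1 i, fun _ => ⟨v.2, ?_, fun i => by rw [hv]; rfl⟩⟩
      have := hwc j
      rw [hv] at this
      exact this
    · exact ⟨0, fun h => absurd h hj⟩
  choose g hg using hg
  have hdom : ∀ v : I → ℕ, ∑ i, v i = N → ∃ i ∈ C, ∀ j ∈ C, v i ≤ g j i := by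
    intro v hv
    obtain ⟨a, ha⟩ := hV v hv
    obtain ⟨i, hi⟩ := hw (Sum.inr a)
    have hi' : ∀ j, v i + 1 ≤ val i (w j) := fun j => ha i ▸ hle _ _ _ (hi j)
    refine ⟨i, ?_, fun j hj => ?_⟩
    · by_contra hiC
      have h1 := hi' i
      rw [(hw' i).resolve_right fun h => hiC ((hC i).2 h)] at h1
      simp [val] at h1
    · have := hi' j
      rw [(hg j hj).2.2 i] at this
      omega
  obtain ⟨i₁, hi₁, -⟩ := hdom (Pi.single (Classical.arbitrary I) N) (by simp)
  choose mj hmj hmin using fun i => C.exists_min_image (fun j => g j i) ⟨i₁, hi₁⟩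
  let b : I → ℕ := fun i => if i ∈ C then g (mj i) i else 0
  have hb : ∀ j ∈ C, ∀ i, b i ≤ g j i := by
    intro j hj i
    by_cases hi : i ∈ C
    · simp only [b, if_pos hi]
      exact hmin i j hj
    · simp [b, hi]
  -- Otherwise the lower bounds `b i`, for `i ∈ C`, could be raised all at once.
  have hsum : N < ∑ i, b i + Fintype.card I := by
    by_contra! hcon
    have h1 : ∑ i, (b i + if i ∈ C then 1 else 0) ≤ N := by
      refine le_trans ?_ hcon
      rw [Finset.sum_add_distrib]
      refine Nat.add_le_add_left ?_ _
      simp only [Finset.sum_ite_mem, Finset.univ_inter, Finset.sum_const, smul_eq_mul, mul_one]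
      exact Finset.card_le_univ C
    obtain ⟨i, hi, hi'⟩ := hdom (fun i => (b i + if i ∈ C then 1 else 0) +
      if i = i₁ then N - ∑ i, (b i + if i ∈ C then 1 else 0) else 0) (by
        rw [Finset.sum_add_distrib, Finset.sum_ite_eq' Finset.univ i₁]
        simp only [Finset.mem_univ, if_true]
        omega)
    have := hi' (mj i) (hmj i)
    simp only [b, if_pos hi] at this
    omega
  have hclose : ∀ j ∈ C, ∀ i, g j i ≤ b i + Fintype.card I := by
    intro j hj i
    have h1 : ∑ k, (g j k - b k) + ∑ k, b k = N := by
      rw [← Finset.sum_add_distrib, ← (hg j hj).1]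
      exact Finset.sum_congr rfl fun k _ => Nat.sub_add_cancel (hb j hj k)
    have h2 : g j i - b i ≤ ∑ k, (g j k - b k) :=
      Finset.single_le_sum (f := fun k => g j k - b k) (fun _ _ => Nat.zero_le _)
        (Finset.mem_univ i)
    omega
  refine ⟨g i₁, (hg i₁ hi₁).1, fun i => ?_⟩
  by_cases hi : i ∈ C
  · refine Or.inr ⟨g i, (hg i hi).1, (hg i hi).2.1, fun k => ?_⟩
    have := hb i hi k
    have := hb i₁ hi₁ k
    have := hclose i hi k
    have := hclose i₁ hi₁ k
    omega
  · left
    have := hclose i₁ hi₁ i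
    simpa [b, hi] using this

/-- **Brouwer's fixed point theorem** for the standard simplex. -/
theorem exists_fixedPoint_stdSimplex {I : Type*} [Fintype I] [Nonempty I]
    {f : (I → ℝ) → I → ℝ} (hf : ContinuousOn f (stdSimplex ℝ I))
    (hmaps : Set.MapsTo f (stdSimplex ℝ I) (stdSimplex ℝ I)) :
    ∃ x ∈ stdSimplex ℝ I, f x = x := by
  classical
  have hK : IsCompact (stdSimplex ℝ I) := isCompact_stdSimplex ℝ I
  have hne : (stdSimplex ℝ I).Nonempty := ⟨_, single_mem_stdSimplex ℝ (Classical.arbitrary I)⟩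
  have hcont : ContinuousOn
      (fun x => Finset.univ.inf' Finset.univ_nonempty fun i => f x i - x i) (stdSimplex ℝ I) := by
    refine ContinuousOn.finset_inf'_apply _ fun i _ => ?_
    exact ((continuous_apply i).comp_continuousOn hf).sub (continuous_apply i).continuousOn
  obtain ⟨x, hx, hmax⟩ := hK.exists_isMaxOn hne hcont
  -- It is enough that no coordinate decreases at `x`, as the coordinates sum to `1`.
  suffices h : ∀ i, x i ≤ f x i by
    refine ⟨x, hx, funext fun i => ?_⟩
    have h1 : ∑ i, x i = ∑ i, f x i := hx.2.trans (hmaps hx).2.symm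
    exact ((Finset.sum_eq_sum_iff_of_le fun i _ => h i).1 h1 i (Finset.mem_univ i)).symm
  by_contra! hcon
  obtain ⟨i₀, hi₀⟩ := hcon
  set ε := x i₀ - f x i₀ with hε
  have hεpos : 0 < ε := sub_pos.2 hi₀
  -- Every point of the simplex has a coordinate that decreases by at least `ε`.
  have hall : ∀ y ∈ stdSimplex ℝ I, ∃ i, f y i - y i ≤ -ε := by
    intro y hy
    obtain ⟨i, -, hi⟩ := Finset.exists_mem_eq_inf' Finset.univ_nonempty fun i => f y i - y i
    refine ⟨i, ?_⟩
    rw [← hi]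
    refine (hmax hy).trans ((Finset.inf'_le _ (Finset.mem_univ i₀)).trans ?_)
    rw [hε, neg_sub]
  obtain ⟨δ, hδ, huc⟩ := Metric.uniformContinuousOn_iff.1
    (hK.uniformContinuousOn_of_continuous hf) (ε / 3) (by positivity)
  obtain ⟨N, hN⟩ := exists_nat_gt (Fintype.card I / min δ (ε / 3) : ℝ)
  have hmin : 0 < min δ (ε / 3) := lt_min hδ (by positivity)
  have hNpos : (0 : ℝ) < N := lt_of_le_of_lt (by positivity) hN
  have hnN : (Fintype.card I / N : ℝ) < min δ (ε / 3) := by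
    rw [div_lt_iff₀ hNpos]
    rw [div_lt_iff₀ hmin] at hN
    linarith
  let pt : (I → ℕ) → I → ℝ := fun a i => a i / N
  have hpt : ∀ a : I → ℕ, ∑ i, a i = N → pt a ∈ stdSimplex ℝ I := by
    intro a ha
    refine ⟨fun i => by positivity, ?_⟩
    simp only [pt]
    rw [← Finset.sum_div, ← Nat.cast_sum, ha, div_self hNpos.ne']
  have hcol : ∀ a : I → ℕ, ∃ i, ∑ i, a i = N → pt a i ≤ f (pt a) i := by
    intro a
    by_contra! hcon
    have h1 := (hcon (Classical.arbitrary I)).1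
    have h2 : ∑ i, f (pt a) i < ∑ i, pt a i :=
      Finset.sum_lt_sum_of_nonempty Finset.univ_nonempty fun i _ => (hcon i).2
    rw [(hpt a h1).2, (hmaps (hpt a h1)).2] at h2
    exact lt_irrefl _ h2
  choose c hc using hcol
  obtain ⟨w, hw, hwi⟩ := exists_lattice_point_near_colors N c
  obtain ⟨i, hi⟩ := hall _ (hpt w hw)
  rcases hwi i with h | ⟨v, hv, hvc, hvw⟩
  · have h1 : pt w i ≤ Fintype.card I / N := by
      simp only [pt]
      gcongr
    have h2 := (hmaps (hpt w hw)).1 i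
    have := min_le_right δ (ε / 3)
    linarith
  · have hd : ∀ k, |pt w k - pt v k| ≤ Fintype.card I / N := by
      intro k
      have h1 : (v k : ℝ) ≤ w k + Fintype.card I := by exact_mod_cast (hvw k).1
      have h2 : (w k : ℝ) ≤ v k + Fintype.card I := by exact_mod_cast (hvw k).2
      simp only [pt]
      rw [← sub_div, abs_div, abs_of_pos hNpos]
      gcongr
      rw [abs_le]
      constructor <;> linarith
    have h1 : dist (pt w) (pt v) < δ := by
      refine (dist_pi_lt_iff hδ).2 fun k => ?_
      rw [Real.dist_eq]
      exact (hd k).trans_lt (hnN.trans_le (min_le_left _ _))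
    have h2 := (dist_le_pi_dist _ _ i).trans_lt (huc _ (hpt w hw) _ (hpt v hv) h1)
    rw [Real.dist_eq] at h2
    have h3 := hc v hv
    rw [hvc] at h3
    have h4 := (abs_le.1 ((hd i).trans (hnN.le.trans (min_le_right _ _)))).2
    have h5 := (abs_lt.1 h2).1
    linarith

/-- **Brouwer's fixed point theorem** for a box. -/
theorem exists_fixedPoint_Icc {ι : Type*} [Fintype ι] {b : ι → ℝ} (hb : 0 ≤ b)
    {h : (ι → ℝ) → ι → ℝ} (hh : ContinuousOn h (Set.Icc 0 b))
    (hmaps : Set.MapsTo h (Set.Icc 0 b) (Set.Icc 0 b)) :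
    ∃ z ∈ Set.Icc 0 b, h z = z := by
  classical
  -- The box is a retract of the simplex `{z | 0 ≤ z, ∑ z i ≤ T}`, which is the standard simplex
  -- with vertices indexed by `Option ι`, up to scaling by `T`.
  set T : ℝ := ∑ i, b i + 1 with hT
  have hTpos : 0 < T := add_pos_of_nonneg_of_pos (Finset.sum_nonneg fun i _ => hb i) one_pos
  let ρ : (Option ι → ℝ) → ι → ℝ := fun x i => max 0 (min (T * x (some i)) (b i))
  have hρ : ∀ x, ρ x ∈ Set.Icc 0 b := fun x =>
    ⟨fun i => le_max_left _ _, fun i => max_le (hb i) (min_le_right _ _)⟩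
  have hρc : Continuous ρ := by fun_prop
  let f : (Option ι → ℝ) → Option ι → ℝ := fun x o =>
    o.elim (1 - ∑ i, h (ρ x) i / T) fun i => h (ρ x) i / T
  have hhρ : Continuous fun x => h (ρ x) := hh.comp_continuous hρc hρ
  have hf : Continuous f := by
    refine continuous_pi fun o => ?_
    have hi : ∀ i, Continuous fun x => h (ρ x) i / T := fun i =>
      ((continuous_apply i).comp hhρ).div_const T
    cases o with
    | none => exact continuous_const.sub (continuous_finsetSum _ fun i _ => hi i)
    | some i => exact hi i
  obtain ⟨x, -, hfx⟩ := exists_fixedPoint_stdSimplex hf.continuousOn (fun x hx => by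
    have h0 := hmaps (hρ x)
    refine ⟨fun o => ?_, ?_⟩
    · cases o with
      | none =>
        simp only [f, Option.elim_none, sub_nonneg]
        rw [← Finset.sum_div, div_le_one hTpos]
        have : ∑ i, h (ρ x) i ≤ ∑ i, b i := Finset.sum_le_sum fun i _ => h0.2 i
        linarith
      | some i => exact div_nonneg (h0.1 i) hTpos.le
    · rw [Fintype.sum_option]
      simp [f])
  have hz : ∀ i, T * x (some i) = h (ρ x) i := by
    intro i
    have := congrFun hfx (some i)
    simp only [f, Option.elim_some] at this
    rw [← this]
    field_simp
  refine ⟨ρ x, hρ x, funext fun i => ?_⟩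
  have h0 := hmaps (hρ x)
  change h (ρ x) i = max 0 (min (T * x (some i)) (b i))
  rw [hz i, min_eq_left (h0.2 i), max_eq_right (show 0 ≤ h (ρ x) i from h0.1 i)]

/-- A continuous vector field on a box solves its variational inequality at some point (the
Hartman–Stampacchia theorem for a box). -/
theorem exists_variationalInequality_Icc {ι : Type*} [Fintype ι] {b : ι → ℝ} (hb : 0 ≤ b)
    {F : (ι → ℝ) → ι → ℝ} (hF : ContinuousOn F (Set.Icc 0 b)) :
    ∃ z ∈ Set.Icc 0 b, ∀ i, (z i < b i → 0 ≤ F z i) ∧ (0 < z i → F z i ≤ 0) := by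
  obtain ⟨z, hz, hfix⟩ := exists_fixedPoint_Icc hb
    (h := fun z i => max 0 (min (z i - F z i) (b i)))
    (continuousOn_pi.2 fun i => continuousOn_const.sup
      (((continuous_apply i).continuousOn.sub ((continuous_apply i).comp_continuousOn hF)).inf
        continuousOn_const))
    (fun z _ => ⟨fun i => le_max_left _ _, fun i => max_le (hb i) (min_le_right _ _)⟩)
  refine ⟨z, hz, fun i => ?_⟩
  have h1 : max 0 (min (z i - F z i) (b i)) = z i := congrFun hfix i
  constructor
  · intro h2
    by_contra! h3
    have : z i < min (z i - F z i) (b i) := lt_min (by linarith) h2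
    exact absurd (this.trans_le (le_max_right 0 _)) (by rw [h1]; exact lt_irrefl _)
  · intro h2
    by_contra! h3
    have : max 0 (min (z i - F z i) (b i)) < z i :=
      max_lt h2 ((min_le_left _ _).trans_lt (by linarith))
    exact absurd this (by rw [h1]; exact lt_irrefl _)

end Brouwer

namespace FluidModel

/-! ### Existence of an equilibrium -/

section Existence

variable {L S : Type*} {Rt : S → Type*} (N : FluidModel L S Rt)

theorem H_nonneg (l : L) (r : Σ s, Rt s) : 0 ≤ N.H l r := by
  unfold H
  split_ifs <;> norm_num

theorem H_le_one (l : L) (r : Σ s, Rt s) : N.H l r ≤ 1 := by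
  unfold H
  split_ifs <;> norm_num

theorem H_eq_one {l : L} {s : S} {r : Rt s} (h : l ∈ N.links s r) : N.H l ⟨s, r⟩ = 1 := by
  simp [H, h]

/-- The aggregate price of a route is at least the price of each of its links. -/
theorem price_le_routePrice [Fintype L] {p : L → ℝ} (hp : 0 ≤ p) {s : S} {r : Rt s} {l : L}
    (hl : l ∈ N.links s r) : p l ≤ N.routePrice p s r := by
  have := Finset.single_le_sum (f := fun l => N.H l ⟨s, r⟩ * p l)
    (fun l _ => mul_nonneg (N.H_nonneg l _) (hp l)) (Finset.mem_univ l)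
  rwa [N.H_eq_one hl, one_mul] at this

theorem rate_le_load [Fintype S] [∀ s, Fintype (Rt s)] {x : ∀ s, Rt s → ℝ}
    (hx : ∀ s r, 0 ≤ x s r) {s : S} {r : Rt s} {l : L} (hl : l ∈ N.links s r) :
    x s r ≤ N.load x l := by
  have := Finset.single_le_sum (f := fun r : Σ s, Rt s => N.H l r * x r.1 r.2)
    (fun r _ => mul_nonneg (N.H_nonneg l r) (hx r.1 r.2)) (Finset.mem_univ (⟨s, r⟩ : Σ s, Rt s))
  rwa [N.H_eq_one hl, one_mul] at this

/-- If the load on a link is at least its capacity, then some route through the link carries at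
least an even share of the capacity. The `+ 1` keeps the share positive and well defined when there
are no routes. -/
theorem exists_rate_ge [Fintype S] [∀ s, Fintype (Rt s)] {x : ∀ s, Rt s → ℝ} {l : L}
    (hl : N.c l ≤ N.load x l) :
    ∃ s, ∃ r : Rt s, l ∈ N.links s r ∧ N.c l / (Fintype.card (Σ s, Rt s) + 1) ≤ x s r := by
  by_contra! hcon
  have hcard : (0 : ℝ) < Fintype.card (Σ s, Rt s) + 1 := by positivity
  have hδ : 0 < N.c l / (Fintype.card (Σ s, Rt s) + 1) := div_pos (N.c_pos l) hcard
  have h1 : N.load x l ≤ ∑ _r : Σ s, Rt s, N.c l / (Fintype.card (Σ s, Rt s) + 1) := by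
    refine Finset.sum_le_sum fun r _ => ?_
    by_cases hr : l ∈ N.links r.1 r.2
    · rw [N.H_eq_one hr, one_mul]
      exact (hcon r.1 r.2 hr).le
    · have : N.H l r = 0 := by simp [H, hr]
      rw [this, zero_mul]
      exact hδ.le
  rw [Finset.sum_const, Finset.card_univ, nsmul_eq_mul] at h1
  have h2 : N.c l = (Fintype.card (Σ s, Rt s) + 1) * (N.c l / (Fintype.card (Σ s, Rt s) + 1)) := by
    field_simp
  nlinarith

/-- On rate vectors bounded by `B`, a route that carries at least an even share of the capacity of
one of its links has a bounded `φ`. -/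
theorem IsRegular.exists_bound {N : FluidModel L S Rt} [Fintype L] [Fintype S]
    [∀ s, Fintype (Rt s)] (h : N.IsRegular) (B : ℝ) :
    ∃ M : ℝ, 0 ≤ M ∧ ∀ (l : L) (s : S) (r : Rt s) (xs : Rt s → ℝ), 0 ≤ xs → (∀ r, xs r ≤ B) →
      N.c l / (Fintype.card (Σ s, Rt s) + 1) ≤ xs r → (N.φ s r xs).toReal ≤ M := by
  have key : ∀ i : L × Σ s, Rt s, ∃ M : ℝ, ∀ xs : Rt i.2.1 → ℝ, 0 ≤ xs → (∀ r, xs r ≤ B) →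
      N.c i.1 / (Fintype.card (Σ s, Rt s) + 1) ≤ xs i.2.2 →
      (N.φ i.2.1 i.2.2 xs).toReal ≤ M := by
    rintro ⟨l, s, r⟩
    have hδ : 0 < N.c l / ((Fintype.card (Σ s, Rt s) : ℝ) + 1) :=
      div_pos (N.c_pos l) (by positivity)
    set δ := N.c l / ((Fintype.card (Σ s, Rt s) : ℝ) + 1)
    have hK : IsCompact (Set.Icc (0 : Rt s → ℝ) (fun _ => B) ∩ {xs | δ ≤ xs r}) :=
      isCompact_Icc.inter_right (isClosed_le continuous_const (continuous_apply r))
    have hcont : ContinuousOn (fun xs => (N.φ s r xs).toReal)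
        (Set.Icc (0 : Rt s → ℝ) (fun _ => B) ∩ {xs | δ ≤ xs r}) :=
      ENNReal.continuousOn_toReal.comp ((h s r).1.mono fun xs hxs => hxs.1.1)
        fun xs hxs => (h s r).2 xs hxs.1.1 (hδ.trans_le hxs.2)
    obtain ⟨M, hM⟩ := hK.bddAbove_image hcont
    exact ⟨M, fun xs h0 hB hxs => hM ⟨xs, ⟨⟨h0, hB⟩, hxs⟩, rfl⟩⟩
  choose M hM using key
  refine ⟨∑ i, |M i|, Finset.sum_nonneg fun _ _ => abs_nonneg _, fun l s r xs h0 hB hxs => ?_⟩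
  exact (hM ⟨l, s, r⟩ xs h0 hB hxs).trans ((le_abs_self _).trans
    (Finset.single_le_sum (f := fun i => |M i|) (fun _ _ => abs_nonneg _) (Finset.mem_univ _)))

/-- The complementarity problem of the fluid model, with `φ` truncated at the level `K`, restricted
to rates at most `B` and prices at most `P`. -/
theorem IsRegular.exists_truncated_equilibrium {N : FluidModel L S Rt} [Fintype L] [Fintype S]
    [∀ s, Fintype (Rt s)] (h : N.IsRegular) {B P K : ℝ} (hB : 0 ≤ B) (hP : 0 ≤ P) :
    ∃ (x : ∀ s, Rt s → ℝ) (p : L → ℝ),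
      (∀ s r, 0 ≤ x s r ∧ x s r ≤ B ∧
        (x s r < B → (min (N.φ s r (x s)) (ENNReal.ofReal K)).toReal ≤ N.routePrice p s r) ∧
        (0 < x s r → N.routePrice p s r ≤ (min (N.φ s r (x s)) (ENNReal.ofReal K)).toReal)) ∧
      ∀ l, 0 ≤ p l ∧ p l ≤ P ∧ (p l < P → N.load x l ≤ N.c l) ∧
        (0 < p l → N.c l ≤ N.load x l) := by
  let X : ((Σ s, Rt s) ⊕ L → ℝ) → ∀ s, Rt s → ℝ := fun z s r => z (Sum.inl ⟨s, r⟩)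
  let Q : ((Σ s, Rt s) ⊕ L → ℝ) → L → ℝ := fun z l => z (Sum.inr l)
  let F : ((Σ s, Rt s) ⊕ L → ℝ) → (Σ s, Rt s) ⊕ L → ℝ := fun z => Sum.elim
    (fun r => N.routePrice (Q z) r.1 r.2 -
      (min (N.φ r.1 r.2 (X z r.1)) (ENNReal.ofReal K)).toReal)
    (fun l => N.c l - N.load (X z) l)
  let b : (Σ s, Rt s) ⊕ L → ℝ := Sum.elim (fun _ => B) (fun _ => P)
  have hb : 0 ≤ b := by
    rintro (r | l)
    · exact hB
    · exact hP
  have hF : ContinuousOn F (Set.Icc 0 b) := by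
    refine continuousOn_pi.2 fun i => ?_
    rcases i with ⟨s, r⟩ | l
    · refine ContinuousOn.sub (Continuous.continuousOn ?_) ?_
      · exact continuous_finsetSum _ fun l _ => continuous_const.mul (continuous_apply _)
      · refine ENNReal.continuousOn_toReal.comp (ContinuousOn.inf ?_ continuousOn_const)
          fun z _ => ne_top_of_le_ne_top ENNReal.ofReal_ne_top (min_le_right _ _)
        exact (h s r).1.comp (Continuous.continuousOn (by fun_prop)) fun z hz r => hz.1 _
    · refine Continuous.continuousOn (continuous_const.sub ?_)
      exact continuous_finsetSum _ fun r _ => continuous_const.mul (continuous_apply _)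
  obtain ⟨z, hz, hVI⟩ := exists_variationalInequality_Icc hb hF
  refine ⟨X z, Q z, fun s r => ⟨hz.1 _, hz.2 (Sum.inl ⟨s, r⟩), fun h1 => ?_, fun h1 => ?_⟩,
    fun l => ⟨hz.1 _, hz.2 (Sum.inr l), fun h1 => ?_, fun h1 => ?_⟩⟩
  · exact sub_nonneg.1 ((hVI (Sum.inl ⟨s, r⟩)).1 h1)
  · exact sub_nonpos.1 ((hVI (Sum.inl ⟨s, r⟩)).2 h1)
  · exact sub_nonneg.1 ((hVI (Sum.inr l)).1 h1)
  · exact sub_nonpos.1 ((hVI (Sum.inr l)).2 h1)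

/-- A regular fluid model has an equilibrium. -/
theorem IsRegular.exists_isEquilibrium {N : FluidModel L S Rt} [Fintype L] [Fintype S]
    [∀ s, Fintype (Rt s)] (h : N.IsRegular) :
    ∃ (x : ∀ s, Rt s → ℝ) (p : L → ℝ), N.IsEquilibrium x p := by
  obtain ⟨B, hB0, hB⟩ : ∃ B : ℝ, 0 ≤ B ∧ ∀ l, N.c l < B := by
    refine ⟨∑ l, N.c l + 1, add_nonneg (Finset.sum_nonneg fun l _ => (N.c_pos l).le) zero_le_one,
      fun l => lt_add_of_le_of_pos ?_ one_pos⟩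
    exact Finset.single_le_sum (f := N.c) (fun l _ => (N.c_pos l).le) (Finset.mem_univ l)
  obtain ⟨M, hM0, hM⟩ := h.exists_bound B
  set K : ℝ := ∑ _l : L, M + 1 with hK
  have hK0 : 0 ≤ K := add_nonneg (Finset.sum_nonneg fun _ _ => hM0) zero_le_one
  obtain ⟨x, p, hx, hp⟩ := h.exists_truncated_equilibrium (K := K) hB0
    (by linarith : 0 ≤ M + 1)
  have hx0 : ∀ s, 0 ≤ x s := fun s r => (hx s r).1
  have hp0 : 0 ≤ p := fun l => (hp l).1
  -- A link with a positive price is saturated, so it lies on a route with a substantial rate,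
  -- whose price equals its (bounded) `φ`.
  have hpM : ∀ l, p l ≤ M := by
    intro l
    rcases (hp0 l).eq_or_lt with h0 | hpos
    · rw [← h0]
      exact hM0
    obtain ⟨s, r, hl, hr⟩ := N.exists_rate_ge ((hp l).2.2.2 hpos)
    have hrpos : 0 < x s r := lt_of_lt_of_le (div_pos (N.c_pos l) (by positivity)) hr
    refine (N.price_le_routePrice hp0 hl).trans (((hx s r).2.2.2 hrpos).trans ?_)
    refine le_trans ?_ (hM l s r (x s) (hx0 s) (fun r => (hx s r).2.1) hr)
    exact ENNReal.toReal_mono ((h s r).2 _ (hx0 s) hrpos) (min_le_left _ _)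
  have hload : ∀ l, N.load x l ≤ N.c l := fun l =>
    (hp l).2.2.1 ((hpM l).trans_lt (lt_add_one M))
  have hxB : ∀ s r, x s r < B := by
    intro s r
    obtain ⟨l, hl⟩ := N.links_nonempty s r
    exact ((N.rate_le_load (fun s r => (hx s r).1) hl).trans (hload l)).trans_lt (hB l)
  have hq : ∀ s r, N.routePrice p s r < K := by
    intro s r
    have : N.routePrice p s r ≤ ∑ _l : L, M := Finset.sum_le_sum fun l _ =>
      (mul_le_of_le_one_left (hp0 l) (N.H_le_one l _)).trans (hpM l)
    linarith
  -- The prices of the routes are below the level of the truncation, which is therefore void.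
  have hφ : ∀ s r, min (N.φ s r (x s)) (ENNReal.ofReal K) = N.φ s r (x s) := by
    intro s r
    refine min_eq_left (le_of_not_gt fun hlt => ?_)
    have h1 := (hx s r).2.2.1 (hxB s r)
    rw [min_eq_right hlt.le, ENNReal.toReal_ofReal hK0] at h1
    exact absurd h1 (not_le.2 (hq s r))
  have hfin : ∀ s r, N.φ s r (x s) ≠ ∞ := fun s r => by
    rw [← hφ s r]
    exact ne_top_of_le_ne_top ENNReal.ofReal_ne_top (min_le_right _ _)
  refine ⟨x, p, fun s r => ⟨(hx s r).1, ?_, fun hpos => le_antisymm ?_ ?_⟩,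
    fun l => ⟨hp0 l, hload l, fun hpos => le_antisymm (hload l) ((hp l).2.2.2 hpos)⟩⟩
  · have h1 := (hx s r).2.2.1 (hxB s r)
    rw [hφ] at h1
    exact (ENNReal.le_ofReal_iff_toReal_le (hfin s r) (N.routePrice_nonneg hp0 s r)).2 h1
  · have h1 := (hx s r).2.2.1 (hxB s r)
    rw [hφ] at h1
    exact (ENNReal.le_ofReal_iff_toReal_le (hfin s r) (N.routePrice_nonneg hp0 s r)).2 h1
  · have h1 := (hx s r).2.2.2 hpos
    rw [hφ] at h1
    exact ENNReal.ofReal_le_of_le_toReal h1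

end Existence

/-! ### Uniqueness of the equilibrium -/

section Uniqueness

variable {L S : Type*} {Rt : S → Type*} {N : FluidModel L S Rt}

/-- A negative definite Jacobian makes `Φ_s` strictly decreasing, in the sense of monotone
operators. -/
theorem HasNegDefJacobian.inner_sub_neg [∀ s, Fintype (Rt s)] (h : N.HasNegDefJacobian) (s : S)
    {x y : Rt s → ℝ} (hx : ∀ r, 0 < x r) (hy : ∀ r, 0 < y r) (hxy : x ≠ y) :
    ∑ r, (y r - x r) * (N.realΦ s y r - N.realΦ s x r) < 0 := by
  classical
  obtain ⟨-, hdiff, hneg⟩ := h s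
  have hopen : IsOpen {xs : Rt s → ℝ | ∀ r, 0 < xs r} := by
    simp only [Set.ofPred_forall]
    exact isOpen_iInter_of_finite fun r => isOpen_lt continuous_const (continuous_apply r)
  set v := y - x with hv
  have hv0 : v ≠ 0 := sub_ne_zero.2 hxy.symm
  have hseg : ∀ t ∈ Set.Icc (0 : ℝ) 1, ∀ r, 0 < (x + t • v) r := by
    intro t ht r
    have h1 : (x + t • v) r = (1 - t) * x r + t * y r := by
      simp only [hv, Pi.add_apply, Pi.smul_apply, Pi.sub_apply, smul_eq_mul]
      ring
    rw [h1]
    rcases ht.1.eq_or_lt with h0 | h0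
    · rw [← h0]
      simpa using hx r
    · exact add_pos_of_nonneg_of_pos (mul_nonneg (sub_nonneg.2 ht.2) (hx r).le)
        (mul_pos h0 (hy r))
  have hderiv : ∀ t ∈ Set.Icc (0 : ℝ) 1, HasDerivAt
      (fun t => ∑ r, v r * N.realΦ s (x + t • v) r)
      (∑ r, v r * fderiv ℝ (N.realΦ s) (x + t • v) v r) t := by
    intro t ht
    have h1 : HasFDerivAt (N.realΦ s) (fderiv ℝ (N.realΦ s) (x + t • v)) (x + t • v) :=
      ((hdiff.contDiffAt (hopen.mem_nhds (hseg t ht))).differentiableAt one_ne_zero).hasFDerivAt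
    have h2 : HasDerivAt (fun t : ℝ => x + t • v) v t := by
      simpa using ((hasDerivAt_id t).smul_const v).const_add x
    have h3 := hasDerivAt_pi.1 (h1.comp_hasDerivAt t h2)
    exact HasDerivAt.fun_sum fun r _ => (h3 r).const_mul (v r)
  have hquad : ∀ t ∈ Set.Icc (0 : ℝ) 1,
      ∑ r, v r * fderiv ℝ (N.realΦ s) (x + t • v) v r < 0 := by
    intro t ht
    have hpd := (hneg _ (hseg t ht)).dotProduct_mulVec_pos hv0
    have hD : ∀ (D : (Rt s → ℝ) →L[ℝ] Rt s → ℝ) (r : Rt s),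
        D v r = ∑ j, D (Pi.single j 1) r * v j := by
      intro D r
      conv_lhs => rw [show v = ∑ j, v j • Pi.single j (1 : ℝ) from pi_eq_sum_univ' v]
      rw [map_sum, Finset.sum_apply]
      simp only [map_smul, Pi.smul_apply, smul_eq_mul]
      exact Finset.sum_congr rfl fun j _ => mul_comm _ _
    have hJ : ∀ r, fderiv ℝ (N.realΦ s) (x + t • v) v r =
        (N.jacobian s (x + t • v)).mulVec v r := hD _
    have h1 : ∑ r, v r * fderiv ℝ (N.realΦ s) (x + t • v) v r =
        dotProduct v ((N.jacobian s (x + t • v)).mulVec v) :=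
      Finset.sum_congr rfl fun r _ => by rw [hJ]
    have h2 : dotProduct v ((N.jacobian s (x + t • v)).transpose.mulVec v) =
        dotProduct v ((N.jacobian s (x + t • v)).mulVec v) := by
      rw [Matrix.mulVec_transpose, dotProduct_comm, Matrix.dotProduct_mulVec]
    rw [star_trivial, Matrix.neg_mulVec, dotProduct_neg, Matrix.smul_mulVec, dotProduct_smul,
      Matrix.add_mulVec, dotProduct_add, h2, smul_eq_mul] at hpd
    rw [h1]
    linarith
  have hanti : StrictAntiOn (fun t => ∑ r, v r * N.realΦ s (x + t • v) r) (Set.Icc (0 : ℝ) 1) := by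
    refine strictAntiOn_of_deriv_neg (convex_Icc _ _)
      (fun t ht => (hderiv t ht).continuousAt.continuousWithinAt) fun t ht => ?_
    have ht' := interior_subset ht
    rw [(hderiv t ht').deriv]
    exact hquad t ht'
  have h01 := hanti (Set.left_mem_Icc.2 zero_le_one) (Set.right_mem_Icc.2 zero_le_one) one_pos
  have hxy' : x + v = y := by rw [hv, add_sub_cancel]
  simp only [zero_smul, add_zero, one_smul, hxy'] at h01
  have : ∑ r, (y r - x r) * (N.realΦ s y r - N.realΦ s x r) =
      ∑ r, v r * N.realΦ s y r - ∑ r, v r * N.realΦ s x r := by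
    rw [← Finset.sum_sub_distrib]
    exact Finset.sum_congr rfl fun r _ => by rw [hv, Pi.sub_apply]; ring
  rw [this]
  linarith

variable [Fintype S] [∀ s, Fintype (Rt s)]

/-- Two link equilibria have loads and prices that differ in the same direction. -/
theorem IsLinkEquilibrium.sub_mul_sub_nonneg {x x' : ∀ s, Rt s → ℝ} {p p' : L → ℝ}
    (h : N.IsLinkEquilibrium x p) (h' : N.IsLinkEquilibrium x' p') (l : L) :
    0 ≤ (N.load x' l - N.load x l) * (p' l - p l) := by
  have key : ∀ {x : ∀ s, Rt s → ℝ} {p : L → ℝ}, N.IsLinkEquilibrium x p →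
      N.load x l * p l = N.c l * p l := by
    intro x p h
    rcases (h l).1.eq_or_lt with h0 | h0
    · rw [← h0, mul_zero, mul_zero]
    · rw [(h l).2.2 h0]
  have h1 := key h
  have h2 := key h'
  have h3 := mul_le_mul_of_nonneg_right (h l).2.1 (h' l).1
  have h4 := mul_le_mul_of_nonneg_right (h' l).2.1 (h l).1
  nlinarith

variable [Fintype L]

/-- Where `φ` is infinite at zero rates, all rates of an equilibrium are positive. -/
theorem IsEquilibrium.rate_pos (h3 : N.HasInfinitePriceAtZero) {x : ∀ s, Rt s → ℝ} {p : L → ℝ}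
    (h : N.IsEquilibrium x p) (s : S) (r : Rt s) : 0 < x s r := by
  refine lt_of_le_of_ne (h.1 s r).1 fun h0 => ?_
  have h1 := (h3.1 s r (x s) fun r => (h.1 s r).1).2 h0.symm
  have h2 := (h.1 s r).2.1
  rw [h1] at h2
  exact ENNReal.ofReal_ne_top (top_le_iff.1 h2)

theorem IsEquilibrium.realΦ_eq (h3 : N.HasInfinitePriceAtZero) {x : ∀ s, Rt s → ℝ} {p : L → ℝ}
    (h : N.IsEquilibrium x p) (s : S) (r : Rt s) :
    N.realΦ s (x s) r = N.routePrice p s r := by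
  rw [realΦ, (h.1 s r).2.2 (h.rate_pos h3 s r),
    ENNReal.toReal_ofReal (N.routePrice_nonneg (fun l => (h.2 l).1) s r)]

/-- The routing matrix and its transpose are adjoint. -/
theorem sum_mul_routePrice (x : ∀ s, Rt s → ℝ) (p : L → ℝ) :
    ∑ s, ∑ r, x s r * N.routePrice p s r = ∑ l, N.load x l * p l := by
  rw [← Fintype.sum_sigma' (fun s r => x s r * N.routePrice p s r)]
  simp only [routePrice, load, Finset.mul_sum, Finset.sum_mul]
  rw [Finset.sum_comm]
  exact Finset.sum_congr rfl fun l _ => Finset.sum_congr rfl fun r _ => by ring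

/-- For a routing matrix of full row rank, the prices of the routes determine those of the
links. -/
theorem HasInfinitePriceAtZero.routePrice_injective (h3 : N.HasInfinitePriceAtZero)
    {p p' : L → ℝ} (h : ∀ s r, N.routePrice p s r = N.routePrice p' s r) : p = p' := by
  have hli : LinearIndependent ℝ N.H.row := by
    rw [linearIndependent_iff_card_eq_finrank_span, Set.finrank,
      ← Matrix.rank_eq_finrank_span_row, h3.2]
  refine Matrix.vecMul_injective_iff.2 hli (funext fun r => ?_)
  have := h r.1 r.2
  simp only [routePrice] at this
  simp only [Matrix.vecMul, dotProduct]
  rw [Finset.sum_congr rfl fun l _ => mul_comm _ _, this]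
  exact Finset.sum_congr rfl fun l _ => mul_comm _ _

/-- Strict monotonicity of `Φ` and the complementarity between loads and prices leave room for one
equilibrium only. -/
theorem IsEquilibrium.unique (h2 : N.HasNegDefJacobian) (h3 : N.HasInfinitePriceAtZero)
    {x x' : ∀ s, Rt s → ℝ} {p p' : L → ℝ} (h : N.IsEquilibrium x p)
    (h' : N.IsEquilibrium x' p') : x = x' ∧ p = p' := by
  -- `(x' - x) · (q' - q)` equals `(y' - y) · (p' - p)`.
  have hsum : ∑ s, ∑ r, (x' s r - x s r) * (N.realΦ s (x' s) r - N.realΦ s (x s) r) =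
      ∑ l, (N.load x' l - N.load x l) * (p' l - p l) := by
    simp only [h.realΦ_eq h3, h'.realΦ_eq h3, sub_mul, mul_sub, Finset.sum_sub_distrib,
      sum_mul_routePrice]
  have hnonneg : 0 ≤ ∑ l, (N.load x' l - N.load x l) * (p' l - p l) :=
    Finset.sum_nonneg fun l _ => h.2.sub_mul_sub_nonneg h'.2 l
  have hneg : ∀ s, x s ≠ x' s →
      ∑ r, (x' s r - x s r) * (N.realΦ s (x' s) r - N.realΦ s (x s) r) < 0 := fun s hs =>
    h2.inner_sub_neg s (h.rate_pos h3 s) (h'.rate_pos h3 s) hs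
  have hx : x = x' := by
    by_contra hne
    obtain ⟨s₀, hs₀⟩ := Function.ne_iff.1 hne
    have : ∑ s, ∑ r, (x' s r - x s r) * (N.realΦ s (x' s) r - N.realΦ s (x s) r) < 0 := by
      refine Finset.sum_neg' (fun s _ => ?_) ⟨s₀, Finset.mem_univ _, hneg s₀ hs₀⟩
      by_cases hs : x s = x' s
      · simp [hs]
      · exact (hneg s hs).le
    linarith
  subst hx
  exact ⟨rfl, h3.routePrice_injective fun s r =>
    (h.realΦ_eq h3 s r).symm.trans (h'.realΦ_eq h3 s r)⟩

end Uniqueness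

end FluidModel

theorem theorem2 {L S : Type*} {Rt : S → Type*} [Fintype L] [Fintype S] [∀ s, Fintype (Rt s)]
    (N : FluidModel L S Rt) :
    (N.IsRegular → N.HasDecreasingDemand →
      ∃ (x : ∀ s, Rt s → ℝ) (p : L → ℝ), N.IsEquilibrium x p) ∧
    (N.HasNegDefJacobian → N.HasInfinitePriceAtZero →
      ∀ (x x' : ∀ s, Rt s → ℝ) (p p' : L → ℝ),
        N.IsEquilibrium x p → N.IsEquilibrium x' p' → x = x' ∧ p = p') ∧
    (N.IsRegular → N.HasDecreasingDemand → N.HasNegDefJacobian → N.HasInfinitePriceAtZero →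
      ∃! xp : (∀ s, Rt s → ℝ) × (L → ℝ), N.IsEquilibrium xp.1 xp.2) := by
  refine ⟨fun h _ => h.exists_isEquilibrium, fun h2 h3 x x' p p' h h' => h.unique h2 h3 h',
    fun h _ h2 h3 => ?_⟩
  obtain ⟨x, p, hxp⟩ := h.exists_isEquilibrium
  exact ⟨(x, p), hxp, fun xp' h' => Prod.ext (h'.unique h2 h3 hxp).1 (h'.unique h2 h3 hxp).2⟩
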